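/- Let $n\ge 1$, write $\langle n\rangle=\{1,\dots,n\}$, and let $P$ be an entrywise nonnegative real $n\times n$ matrix. For $n\ge 2$ and $1\le k\le n-1$, $P$ is called a $g_k^+$-matrix if for every $F$ with $\emptyset\ne F\subsetneq\langle n\rangle$ there is $E$ with $\emptyset\neq E\subseteq F^c$ and $|E|\ge\min(k,|F^c|)$ such that $\sum_{j\in F}P_{ij}>0$ for all $i\in E$; for $n=1$, $P$ is called a $g_1^+$-matrix if $P\ne 0$ (and only $k=1$ is considered). The matrix $P$ is primitive if it is irreducible and exactly one of its complex eigenvalues has maximum modulus. A cycle of length $u\ge1$ of $P$ is a sequence $(i_0,i_1,\dots,i_u)$ in $\langle n\rangle$ with $i_u=i_0$ and $P_{i_0i_1},P_{i_1i_2},\dots,P_{i_{u-1}i_u}>0$. Theorem. Let $P$ be a primitive $g_k^+$-matrix, where $k=1$ if $n=1$ and $1\le k\le n-1$ if $n\ge2$, and let $s\ge1$ be the smallest number for which $P$ has a cycle of length $s$. Then $P^g>0$ (all entries of $P^g$ are positive), where $$g=\begin{cases}1 & \text{if } n=1,\\[2pt] \left\lfloor\dfrac{n-s-2}{k}\right\rfloor+2+s\,\bigl[n-\max(2,k)+1\bigr]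 & \text{if } n\ge 2\end{cases}$$ (in particular $g$ is a nonnegative integer; the floor is the integer floor, also of negative numbers). Moreover, for $n\ge2$ and $k=1$ one has $g=n+s(n-2)$. -/

import Mathlib

/-- `P` is sum-positive on `U × V`: `∑ j ∈ V, P i j > 0` for every `i ∈ U`. -/
def IsSumPositiveOn {n : ℕ} (P : Matrix (Fin n) (Fin n) ℝ) (U V : Finset (Fin n)) : Prop :=
  ∀ i ∈ U, 0 < ∑ j ∈ V, P i j

/-- `P` is an (entrywise nonnegative) `g_k^+`-matrix of size `n`.
For `n = 1` the only admissible value is `k = 1` and the condition is `P ≠ 0`;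
for `n ≥ 2` the admissible values are `1 ≤ k ≤ n - 1`. -/
def IsGPlusMatrix {n : ℕ} (k : ℕ) (P : Matrix (Fin n) (Fin n) ℝ) : Prop :=
  (∀ i j, 0 ≤ P i j) ∧
    ((n = 1 ∧ k = 1 ∧ P ≠ 0) ∨
      (2 ≤ n ∧ 1 ≤ k ∧ k ≤ n - 1 ∧
        ∀ F : Finset (Fin n), F.Nonempty → F ⊂ Finset.univ →
          ∃ E : Finset (Fin n), E.Nonempty ∧ E ⊆ Fᶜ ∧ min k Fᶜ.card ≤ E.card ∧
            IsSumPositiveOn P E F))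

/-- `P` is primitive: it is (nonnegative and) irreducible and, among its complex eigenvalues,
exactly one has maximum modulus. -/
def IsSpectrallyPrimitive {n : ℕ} (P : Matrix (Fin n) (Fin n) ℝ) : Prop :=
  P.IsIrreducible ∧
    ∃! z : ℂ, z ∈ spectrum ℂ (P.map Complex.ofReal) ∧
      ∀ w ∈ spectrum ℂ (P.map Complex.ofReal), ‖w‖ ≤ ‖z‖

/-- `P` has a cycle `(i_0, i_1, …, i_u)` of length `u ≥ 1`: `i_u = i_0` and
`P i_t i_{t+1} > 0` for all `t < u`. -/
def HasCycleOfLength {n : ℕ} (P : Matrix (Fin n) (Fin n) ℝ) (u : ℕ) : Prop :=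
  1 ≤ u ∧ ∃ c : Fin (u + 1) → Fin n, c (Fin.last u) = c 0 ∧
    ∀ t : Fin u, 0 < P (c t.castSucc) (c t.succ)

/-- The exponent `g`, an integer: `1` if `n = 1`, and otherwise
`⌊(n - s - 2) / k⌋ + 2 + s * (n - max 2 k + 1)`. All subtractions are true subtractions. -/
def gExponent (n k s : ℕ) : ℤ :=
  if n = 1 then 1
  else ⌊((n : ℚ) - s - 2) / k⌋ + 2 + (s : ℤ) * ((n : ℤ) - max 2 (k : ℤ) + 1)

/-! Positivity of entries of powers is existence of walks. Let `C` be the vertex set of a shortest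
cycle. Walking backwards from `C`, the expansion property adds at least `k` vertices per step, so
every vertex has a walk into `C` of length exactly `⌊(n-s-2)/k⌋ + 2` (`exists_walk_into`). From `c`
in `C`, the sets reached in `s * t` steps increase with `t`, have at least `max 2 k` elements at `t
= 1`, and grow strictly until full (`pow_apply_pos_of_closed_walk`). They cannot stall earlier,
because primitivity makes closed walk lengths have gcd 1: a period `d` would make the spectrum
invariant under a primitive `d`-th root of unity. -/

namespace Matrix

section Walks

variable {ι : Type*} [Fintype ι] [DecidableEq ι] {P : Matrix ι ι ℝ}

theorem pow_apply_nonneg_of_nonneg (hP : ∀ i j, 0 ≤ P i j) (m : ℕ) (i j : ι) :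
    0 ≤ (P ^ m) i j := by
  induction m generalizing j with
  | zero => rw [pow_zero, one_apply]; split_ifs <;> norm_num
  | succ m ih =>
    rw [pow_succ, mul_apply]
    exact Finset.sum_nonneg fun l _ => mul_nonneg (ih l) (hP l j)

/-- A positive entry of `P ^ (a + b)` corresponds to a concatenation of walks. -/
theorem pow_add_apply_pos_iff (hP : ∀ i j, 0 ≤ P i j) (a b : ℕ) (i j : ι) :
    0 < (P ^ (a + b)) i j ↔ ∃ l, 0 < (P ^ a) i l ∧ 0 < (P ^ b) l j := by
  have ha := pow_apply_nonneg_of_nonneg hP a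
  have hb := pow_apply_nonneg_of_nonneg hP b
  rw [pow_add, mul_apply, Finset.sum_pos_iff_of_nonneg fun l _ => mul_nonneg (ha i l) (hb l j)]
  constructor
  · rintro ⟨l, -, hl⟩
    exact ⟨l, lt_of_le_of_ne (ha i l) fun h => by simp [← h] at hl,
      lt_of_le_of_ne (hb l j) fun h => by simp [← h] at hl⟩
  · rintro ⟨l, h₁, h₂⟩
    exact ⟨l, Finset.mem_univ l, mul_pos h₁ h₂⟩

theorem pow_add_apply_pos (hP : ∀ i j, 0 ≤ P i j) {a b : ℕ} {i l j : ι}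
    (h₁ : 0 < (P ^ a) i l) (h₂ : 0 < (P ^ b) l j) : 0 < (P ^ (a + b)) i j :=
  (pow_add_apply_pos_iff hP a b i j).2 ⟨l, h₁, h₂⟩

theorem pow_mul_apply_self_pos (hP : ∀ i j, 0 ≤ P i j) {a : ℕ} {i : ι}
    (h : 0 < (P ^ a) i i) (t : ℕ) : 0 < (P ^ (a * t)) i i := by
  induction t with
  | zero => simp
  | succ t ih => rw [Nat.mul_succ]; exact pow_add_apply_pos hP ih h

theorem pow_apply_pos_of_edges (hP : ∀ i j, 0 ≤ P i j) {f : ℕ → ι}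
    (hf : ∀ t, 0 < P (f t) (f (t + 1))) (a m : ℕ) : 0 < (P ^ m) (f a) (f (a + m)) := by
  induction m with
  | zero => simp
  | succ m ih => exact pow_add_apply_pos hP ih (by simpa [add_assoc] using hf (a + m))

end Walks

/-! ### Spectra of graded and of nonnegative matrices -/

section Spectrum

variable {ι : Type*} [Fintype ι] [DecidableEq ι]

/-- If a diagonal change of variables turns `A` into `ω • A`, the spectrum is stable under
multiplication by `ω`. -/
theorem mul_mem_spectrum_of_grading {A : Matrix ι ι ℂ} {ω : ℂ} {u : ι → ℂ}
    (hu : ∀ i, u i ≠ 0) (h : ∀ i j, A i j ≠ 0 → u j = ω * u i) {z : ℂ}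
    (hz : z ∈ spectrum ℂ A) : ω * z ∈ spectrum ℂ A := by
  rw [← spectrum_toLin', ← Module.End.hasEigenvalue_iff_mem_spectrum] at hz ⊢
  obtain ⟨v, hv⟩ := hz.exists_hasEigenvector
  have hAv : A.mulVec v = z • v := by simpa using hv.apply_eq_smul
  refine Module.End.hasEigenvalue_of_hasEigenvector (x := fun i => u i * v i) ?_
  rw [Module.End.hasEigenvector_iff, Module.End.mem_eigenspace_iff]
  constructor
  · rw [toLin'_apply]
    ext i
    have hi := congrFun hAv i
    simp only [mulVec, dotProduct, Pi.smul_apply, smul_eq_mul] at hi ⊢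
    calc ∑ j, A i j * (u j * v j) = ∑ j, ω * u i * (A i j * v j) := by
          refine Finset.sum_congr rfl fun j _ => ?_
          by_cases hA : A i j = 0
          · simp [hA]
          · rw [h i j hA]; ring
      _ = ω * z * (u i * v i) := by rw [← Finset.mul_sum, hi]; ring
  · intro h0
    refine hv.2 (funext fun i => ?_)
    have := congrFun h0 i
    simpa [hu i] using this

/-- A nonnegative matrix with a closed walk has a nonzero complex eigenvalue. -/
theorem exists_ne_zero_mem_spectrum_of_closed_walk {P : Matrix ι ι ℝ}
    (hP : ∀ i j, 0 ≤ P i j) {m : ℕ} (hm : 0 < m) {c : ι} (hc : 0 < (P ^ m) c c) :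
    ∃ w ∈ spectrum ℂ (P.map Complex.ofReal), w ≠ 0 := by
  by_contra! h0
  -- With all eigenvalues zero this trace vanishes, although its `c`-th summand is positive.
  have htr : ((P.map Complex.ofReal) ^ m).trace = 0 := by
    rw [trace_eq_sum_roots_charpoly]
    refine Multiset.sum_eq_zero fun w hw => ?_
    have hw' := mem_spectrum_iff_isRoot_charpoly.2 (Polynomial.isRoot_of_mem_roots hw)
    rw [spectrum.map_pow_of_pos _ hm] at hw'
    obtain ⟨v, hv, rfl⟩ := hw'
    simp [h0 v hv, hm.ne']
  have hmap : (P.map Complex.ofReal) ^ m = (P ^ m).map Complex.ofReal :=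
    (map_pow Complex.ofRealHom.mapMatrix P m).symm
  have hpos : 0 < (P ^ m).trace :=
    Finset.sum_pos' (fun i _ => pow_apply_nonneg_of_nonneg hP m i i) ⟨c, Finset.mem_univ c, hc⟩
  rw [hmap] at htr
  have : ((P ^ m).trace : ℂ) = 0 := by
    rw [← htr]; simp [trace]
  exact hpos.ne' (by exact_mod_cast this)

end Spectrum

/-- The subgroup of `ℤ` generated by the lengths of the closed walks at `c`. -/
def closedWalkDifferences {ι : Type*} [Fintype ι] [DecidableEq ι] {P : Matrix ι ι ℝ}
    (hP : ∀ i j, 0 ≤ P i j) (c : ι) : AddSubgroup ℤ where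
  carrier := {m | ∃ a b : ℕ, 0 < (P ^ a) c c ∧ 0 < (P ^ b) c c ∧ m = a - b}
  zero_mem' := ⟨0, 0, by simp, by simp, by simp⟩
  add_mem' := by
    rintro _ _ ⟨a, b, ha, hb, rfl⟩ ⟨a', b', ha', hb', rfl⟩
    exact ⟨a + a', b + b', pow_add_apply_pos hP ha ha', pow_add_apply_pos hP hb hb',
      by push_cast; ring⟩
  neg_mem' := by
    rintro _ ⟨a, b, ha, hb, rfl⟩
    exact ⟨b, a, hb, ha, by ring⟩

end Matrix

open Matrix

variable {n : ℕ} {P : Matrix (Fin n) (Fin n) ℝ}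

/-! ### From the spectral condition to aperiodicity -/

namespace IsSpectrallyPrimitive

theorem nonneg (h : IsSpectrallyPrimitive P) (i j : Fin n) : 0 ≤ P i j := h.1.nonneg i j

theorem exists_pow_apply_pos (h : IsSpectrallyPrimitive P) (i j : Fin n) :
    ∃ m > 0, 0 < (P ^ m) i j :=
  (isIrreducible_iff_exists_pow_pos h.nonneg).1 h.1 i j

/-- The closed walks at any vertex have coprime lengths. -/
theorem one_mem_closedWalkDifferences (h : IsSpectrallyPrimitive P) (c : Fin n) :
    (1 : ℤ) ∈ closedWalkDifferences h.nonneg c := by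
  set L := closedWalkDifferences h.nonneg c with hL
  obtain ⟨d₀, hd₀⟩ := Int.subgroup_cyclic L
  obtain ⟨d, hd⟩ : ∃ d : ℕ, ∀ m : ℤ, m ∈ L ↔ (d : ℤ) ∣ m := by
    refine ⟨d₀.natAbs, fun m => ?_⟩
    rw [hd₀, AddSubgroup.mem_closure_singleton, Int.natAbs_dvd]
    simp [Dvd.dvd, mul_comm, eq_comm]
  obtain ⟨m, hm, hmc⟩ := h.exists_pow_apply_pos c c
  have hd0 : d ≠ 0 := by
    rintro rfl
    have : (m : ℤ) ∈ L := ⟨m, 0, hmc, by simp, by simp⟩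
    rw [hd] at this
    simp at this
    omega
  obtain ⟨ω, hω⟩ : ∃ ω : ℂ, IsPrimitiveRoot ω d := ⟨_, Complex.isPrimitiveRoot_exp d hd0⟩
  choose l _ hl using fun i => h.exists_pow_apply_pos c i
  have hgrade : ∀ i j, 0 < P i j → ω ^ l j = ω * ω ^ l i := by
    intro i j hij
    obtain ⟨r, _, hr⟩ := h.exists_pow_apply_pos j c
    -- Two walks from `c` to `j`, closed up by the same return walk: their lengths agree modulo `d`.
    have hmem : ((l j : ℤ) - (l i + 1 : ℕ)) ∈ L := by
      refine ⟨l j + r, l i + 1 + r, pow_add_apply_pos h.nonneg (hl j) hr,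
        pow_add_apply_pos h.nonneg (pow_add_apply_pos h.nonneg (hl i) (by simpa using hij)) hr, ?_⟩
      push_cast; ring
    rw [← pow_succ']
    have hmod : l i + 1 ≡ l j [MOD d] := (Nat.modEq_iff_dvd).2 ((hd _).1 hmem)
    exact (pow_eq_pow_of_modEq hmod hω.pow_eq_one).symm
  obtain ⟨z, ⟨hz, hmax⟩, huniq⟩ := h.2
  have hω0 : ω ≠ 0 := hω.ne_zero hd0
  have hωz : ω * z = z := by
    refine huniq _ ⟨mul_mem_spectrum_of_grading (u := fun i => ω ^ l i)
      (fun i => pow_ne_zero _ hω0) (fun i j hij => hgrade i j ?_) hz, fun w hw => ?_⟩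
    · exact lt_of_le_of_ne (h.nonneg i j) fun h0 => hij (by simp [← h0])
    · rw [norm_mul, hω.norm'_eq_one hd0, one_mul]; exact hmax w hw
  have hz0 : z ≠ 0 := by
    rintro rfl
    obtain ⟨w, hw, hw0⟩ := exists_ne_zero_mem_spectrum_of_closed_walk h.nonneg hm hmc
    exact hw0 (by simpa using hmax w hw)
  have hω1 : ω = 1 := mul_right_cancel₀ hz0 (by rw [hωz, one_mul])
  have : d = 1 := by
    rw [hω1] at hω
    exact hω.unique IsPrimitiveRoot.one
  rw [hd, this]
  simp

/-- Any two vertices are joined by a walk whose length is a multiple of `s`. -/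
theorem exists_pow_mul_apply_pos (h : IsSpectrallyPrimitive P) {s : ℕ} (hs : 1 ≤ s)
    (c x : Fin n) : ∃ t, 0 < (P ^ (s * t)) c x := by
  obtain ⟨a, b, ha, hb, hab⟩ := h.one_mem_closedWalkDifferences c
  obtain ⟨l, _, hl⟩ := h.exists_pow_apply_pos c x
  obtain ⟨r, rfl⟩ : ∃ r, s = r + 1 := ⟨s - 1, by omega⟩
  obtain rfl : a = b + 1 := by omega
  -- Modulo `s`, `r = -1`, so the total length is `-(b + 1) * l + b * l + l = 0`.
  have hw := pow_add_apply_pos h.nonneg (pow_add_apply_pos h.nonneg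
    (pow_mul_apply_self_pos h.nonneg ha (r * l))
    (pow_mul_apply_self_pos h.nonneg hb (r * (r * l)))) hl
  refine ⟨l + b * (r * l), ?_⟩
  convert hw using 3
  ring

end IsSpectrallyPrimitive

/-! ### Shortest cycles -/

namespace HasCycleOfLength

/-- The cycle, unrolled to a periodic infinite walk. -/
theorem exists_periodic {s : ℕ} (h : HasCycleOfLength P s) :
    ∃ f : ℕ → Fin n, (∀ t, f (t + s) = f t) ∧ ∀ t, 0 < P (f t) (f (t + 1)) := by
  obtain ⟨hs, c, hc, hedge⟩ := h
  refine ⟨fun t => c (Fin.castSucc ⟨t % s, Nat.mod_lt _ hs⟩), fun t => by simp, fun t => ?_⟩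
  have he := hedge ⟨t % s, Nat.mod_lt _ hs⟩
  have hlt := Nat.mod_lt t hs
  convert he using 2
  rcases Nat.lt_or_ge (t % s + 1) s with h1 | h1
  · refine congrArg c (Fin.ext ?_)
    change (t + 1) % s = t % s + 1
    rw [← Nat.mod_add_mod, Nat.mod_eq_of_lt h1]
  · have h2 : t % s + 1 = s := by omega
    have h3 : (t + 1) % s = 0 := by rw [← Nat.mod_add_mod, h2, Nat.mod_self]
    have e₁ : (Fin.castSucc ⟨(t + 1) % s, Nat.mod_lt _ hs⟩ : Fin (s + 1)) = 0 := by
      ext; simp [h3]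
    have e₂ : (Fin.succ ⟨t % s, Nat.mod_lt _ hs⟩ : Fin (s + 1)) = Fin.last s := by
      ext; simp [h2]
    exact (congrArg c e₁).trans (hc.symm.trans (congrArg c e₂.symm))

theorem of_edges {f : ℕ → Fin n} (hf : ∀ t, 0 < P (f t) (f (t + 1))) {a m : ℕ} (hm : 1 ≤ m)
    (h : f (a + m) = f a) : HasCycleOfLength P m :=
  ⟨hm, fun t => f (a + t), by simpa using h, fun t => by simpa [add_assoc] using hf (a + t)⟩

end HasCycleOfLength

/-- A shortest cycle has `s` distinct vertices; every one of them has a successor among them and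
carries a closed walk of length `s`. -/
theorem exists_shortest_cycle_vertices (hP : ∀ i j, 0 ≤ P i j) {s : ℕ}
    (hs : IsLeast {u : ℕ | HasCycleOfLength P u} s) :
    ∃ C : Finset (Fin n), C.card = s ∧ (∀ x ∈ C, ∃ y ∈ C, 0 < P x y) ∧
      ∀ x ∈ C, 0 < (P ^ s) x x := by
  obtain ⟨f, hper, hf⟩ := HasCycleOfLength.exists_periodic hs.1
  have hs1 : 1 ≤ s := hs.1.1
  have hmod : ∀ t, f (t % s) = f t := fun t => Function.Periodic.map_mod_nat hper t
  refine ⟨(Finset.range s).image f, ?_, ?_, ?_⟩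
  · rw [Finset.card_image_of_injOn, Finset.card_range]
    -- A repeated vertex would close a cycle shorter than `s`.
    have key : ∀ a b, a < b → b < s → f a ≠ f b := by
      intro a b hab hb heq
      have := hs.2 (HasCycleOfLength.of_edges hf (a := a) (m := b - a) (by omega)
        (by rw [Nat.add_sub_cancel' hab.le, heq]))
      omega
    intro a ha b hb heq
    simp only [Finset.coe_range, Set.mem_Iio] at ha hb
    rcases lt_trichotomy a b with h | h | h
    · exact absurd heq (key a b h hb)
    · exact h
    · exact absurd heq.symm (key b a h ha)
  · intro x hx
    obtain ⟨t, -, rfl⟩ := Finset.mem_image.1 hx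
    exact ⟨f (t + 1), Finset.mem_image.2 ⟨(t + 1) % s, Finset.mem_range.2 (Nat.mod_lt _ hs1),
      hmod _⟩, hf t⟩
  · intro x hx
    obtain ⟨t, -, rfl⟩ := Finset.mem_image.1 hx
    simpa [hper t] using pow_apply_pos_of_edges hP hf t s

/-! ### Expansion and growth of reachable sets -/

/-- The expansion property of `g_k^+`-matrices of size at least `2`. -/
def HasPredecessorExpansion (k : ℕ) (P : Matrix (Fin n) (Fin n) ℝ) : Prop :=
  ∀ F : Finset (Fin n), F.Nonempty → F ⊂ Finset.univ →
    ∃ E : Finset (Fin n), E ⊆ Fᶜ ∧ min k Fᶜ.card ≤ E.card ∧ ∀ i ∈ E, ∃ j ∈ F, 0 < P i j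

theorem IsGPlusMatrix.hasPredecessorExpansion {k : ℕ} (h : IsGPlusMatrix k P) (hn : 2 ≤ n) :
    1 ≤ k ∧ k + 1 ≤ n ∧ HasPredecessorExpansion k P := by
  obtain ⟨hnn, h | ⟨-, hk, hkn, h⟩⟩ := h
  · omega
  refine ⟨hk, by omega, fun F hF hF' => ?_⟩
  obtain ⟨E, -, hE, hcard, hpos⟩ := h F hF hF'
  refine ⟨E, hE, hcard, fun i hi => ?_⟩
  exact (Finset.sum_pos_iff_of_nonneg fun j _ => hnn i j).1 (hpos i hi)

namespace HasPredecessorExpansion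

/-- Every vertex has at least `k` successors. -/
theorem le_card_successors {k : ℕ} (h : HasPredecessorExpansion k P)
    (hkn : k + 1 ≤ n) (v : Fin n) : k ≤ (Finset.univ.filter fun j => 0 < P v j).card := by
  by_contra! hlt
  set N := Finset.univ.filter fun j => 0 < P v j with hN
  have hcard : (insert v N).card ≤ k := (Finset.card_insert_le v N).trans hlt
  have hne : ((insert v N)ᶜ).Nonempty := by
    rw [← Finset.card_pos, Finset.card_compl, Fintype.card_fin]; omega
  have hproper : (insert v N)ᶜ ⊂ Finset.univ := by
    rw [Finset.ssubset_univ_iff, Ne, Finset.compl_eq_univ_iff]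
    exact (Finset.insert_nonempty v N).ne_empty
  -- The complement of this set has at most `k` elements, so `E` is all of it and contains `v`,
  -- giving `v` a successor outside `N`.
  obtain ⟨E, hE, hEcard, hpos⟩ := h _ hne hproper
  rw [compl_compl, min_eq_right hcard] at hEcard
  rw [compl_compl] at hE
  have hEeq := Finset.eq_of_subset_of_card_le hE hEcard
  obtain ⟨j, hj, hvj⟩ := hpos v (hEeq ▸ Finset.mem_insert_self v N)
  rw [Finset.mem_compl] at hj
  exact hj (Finset.mem_insert_of_mem (by simp [hN, hvj]))

/-- If every vertex of `C` has a successor in `C`, every vertex has a walk into `C` of any length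
`t` with `n ≤ |C| + t * k`. -/
theorem exists_walk_into {k : ℕ} (h : HasPredecessorExpansion k P)
    (hP : ∀ i j, 0 ≤ P i j) {C : Finset (Fin n)} (hC : C.Nonempty)
    (hsucc : ∀ x ∈ C, ∃ y ∈ C, 0 < P x y) {t : ℕ} (ht : n ≤ C.card + t * k) (i : Fin n) :
    ∃ y ∈ C, 0 < (P ^ t) i y := by
  classical
  let B : ℕ → Finset (Fin n) := fun t => Finset.univ.filter fun x => ∃ y ∈ C, 0 < (P ^ t) x y
  have hmem : ∀ t x, x ∈ B t ↔ ∃ y ∈ C, 0 < (P ^ t) x y := fun t x => by simp [B]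
  have hmono : ∀ t, B t ⊆ B (t + 1) := by
    intro t x hx
    obtain ⟨y, hy, hxy⟩ := (hmem t x).1 hx
    obtain ⟨w, hw, hyw⟩ := hsucc y hy
    exact (hmem _ _).2 ⟨w, hw, pow_add_apply_pos hP hxy (by simpa using hyw)⟩
  have hCB : ∀ t, C ⊆ B t := by
    intro t
    induction t with
    | zero => exact fun x hx => (hmem _ _).2 ⟨x, hx, by simp⟩
    | succ t ih => exact ih.trans (hmono t)
  have hcard : ∀ t, min n (C.card + t * k) ≤ (B t).card := by
    intro t
    induction t with
    | zero => exact (min_le_right _ _).trans (by simpa using Finset.card_le_card (hCB 0))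
    | succ t ih =>
      by_cases hu : B t = Finset.univ
      · have : B (t + 1) = Finset.univ := Finset.univ_subset_iff.1 (hu ▸ hmono t)
        simp [this]
      obtain ⟨E, hE, hEcard, hpos⟩ := h (B t) (hC.mono (hCB t)) (Finset.ssubset_univ_iff.2 hu)
      have hdisj : Disjoint (B t) E := (Finset.disjoint_of_subset_right hE disjoint_compl_right)
      have hsub : B t ∪ E ⊆ B (t + 1) := by
        refine Finset.union_subset (hmono t) fun x hx => ?_
        obtain ⟨j, hj, hxj⟩ := hpos x hx
        obtain ⟨y, hy, hjy⟩ := (hmem t j).1 hj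
        refine (hmem _ _).2 ⟨y, hy, ?_⟩
        rw [add_comm]
        exact pow_add_apply_pos hP (by simpa using hxj) hjy
      have := Finset.card_le_card hsub
      rw [Finset.card_union_of_disjoint hdisj] at this
      rw [Finset.card_compl, Fintype.card_fin] at hEcard
      have hle := Finset.card_le_univ (B t)
      rw [Fintype.card_fin] at hle
      rw [Nat.succ_mul]
      omega
  have hfull : B t = Finset.univ := by
    rw [← Finset.card_eq_iff_eq_univ, Fintype.card_fin]
    have hle := Finset.card_le_univ (B t)
    rw [Fintype.card_fin] at hle
    have := hcard t
    omega
  exact (hmem t i).1 (hfull ▸ Finset.mem_univ i)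

end HasPredecessorExpansion

/-- From a vertex with a closed walk of length `s`, every vertex is reached in
`s * (n - max 2 k + 1)` steps. -/
theorem IsSpectrallyPrimitive.pow_apply_pos_of_closed_walk (h : IsSpectrallyPrimitive P) {k s : ℕ}
    (hn : 2 ≤ n) (hkn : k + 1 ≤ n) (hexp : HasPredecessorExpansion k P) (hs : 1 ≤ s) {c : Fin n}
    (hc : 0 < (P ^ s) c c) (x : Fin n) : 0 < (P ^ (s * (n - max 2 k + 1))) c x := by
  classical
  have hP := h.nonneg
  let R : ℕ → Finset (Fin n) := fun t => Finset.univ.filter fun x => 0 < (P ^ (s * t)) c x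
  have hmem : ∀ t x, x ∈ R t ↔ 0 < (P ^ (s * t)) c x := fun t x => by simp [R]
  have hmono : ∀ t, R t ⊆ R (t + 1) := by
    intro t x hx
    rw [hmem] at hx ⊢
    rw [Nat.mul_succ, add_comm]
    exact pow_add_apply_pos hP hc hx
  have hstable : ∀ t, R (t + 1) = R t → R t = Finset.univ := by
    intro t ht
    have hstep : ∀ x ∈ R t, ∀ y, 0 < (P ^ s) x y → y ∈ R t := by
      intro x hx y hxy
      rw [← ht, hmem, Nat.mul_succ]
      exact pow_add_apply_pos hP ((hmem t x).1 hx) hxy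
    have hall : ∀ m y, 0 < (P ^ (s * m)) c y → y ∈ R t := by
      intro m
      induction m with
      | zero =>
        intro y hy
        rw [Nat.mul_zero, pow_zero, one_apply] at hy
        split_ifs at hy with hcy
        · subst hcy; exact (hmem _ _).2 (pow_mul_apply_self_pos hP hc t)
        · exact absurd hy (lt_irrefl 0)
      | succ m ih =>
        intro y hy
        rw [Nat.mul_succ, pow_add_apply_pos_iff hP] at hy
        obtain ⟨l, h₁, h₂⟩ := hy
        exact hstep l (ih l h₁) y h₂
    refine Finset.eq_univ_of_forall fun y => ?_
    obtain ⟨m, hm⟩ := h.exists_pow_mul_apply_pos hs c y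
    exact hall m y hm
  have hgrow : ∀ t, min n ((R t).card + 1) ≤ (R (t + 1)).card := by
    intro t
    by_cases heq : R (t + 1) = R t
    · rw [heq, hstable t heq]; simp
    · have := Finset.card_lt_card ((hmono t).ssubset_of_ne (Ne.symm heq))
      omega
  have hone : max 2 k ≤ (R 1).card := by
    refine max_le ?_ ?_
    · have h0 : 1 ≤ (R 0).card := Finset.card_pos.2 ⟨c, (hmem _ _).2 (by simp)⟩
      have := hgrow 0
      rw [zero_add] at this
      omega
    · obtain ⟨r, rfl⟩ : ∃ r, s = r + 1 := ⟨s - 1, by omega⟩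
      -- `l` is reached after `s - 1` steps, so all its successors lie in `R 1`.
      obtain ⟨l, h₁, -⟩ := (pow_add_apply_pos_iff hP r 1 c c).1 hc
      refine (hexp.le_card_successors hkn l).trans (Finset.card_le_card fun y hy => ?_)
      rw [hmem, Nat.mul_one]
      exact pow_add_apply_pos hP h₁ (by simpa using hy)
  have hcard : ∀ t, min n (max 2 k + t) ≤ (R (t + 1)).card := by
    intro t
    induction t with
    | zero => exact (min_le_right _ _).trans hone
    | succ t ih => have := hgrow (t + 1); omega
  have hfull : R (n - max 2 k + 1) = Finset.univ := by
    rw [← Finset.card_eq_iff_eq_univ, Fintype.card_fin]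
    have hle := Finset.card_le_univ (R (n - max 2 k + 1))
    rw [Fintype.card_fin] at hle
    have := hcard (n - max 2 k)
    omega
  exact (hmem _ x).1 (hfull ▸ Finset.mem_univ x)

theorem gExponent_eq_of_two_le {n k s : ℕ} (hn : 2 ≤ n) :
    gExponent n k s =
      ((n : ℤ) - s - 2) / (k : ℤ) + 2 + (s : ℤ) * ((n : ℤ) - max 2 (k : ℤ) + 1) := by
  rw [gExponent, if_neg (by omega), ← Rat.floor_intCast_div_natCast]
  push_cast
  rfl

theorem theorem4p23 {n k s : ℕ} (P : Matrix (Fin n) (Fin n) ℝ)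
    (hP : IsGPlusMatrix k P) (hprim : IsSpectrallyPrimitive P)
    (hs : IsLeast {u : ℕ | HasCycleOfLength P u} s) :
    (∃ g : ℕ, (g : ℤ) = gExponent n k s ∧ ∀ i j, 0 < (P ^ g) i j) ∧
      (2 ≤ n → k = 1 → gExponent n k s = (n : ℤ) + s * ((n : ℤ) - 2)) := by
  refine ⟨?_, fun hn hk => ?_⟩
  · have hnn := hprim.nonneg
    rcases Nat.lt_or_ge n 2 with hn | hn
    · obtain ⟨-, ⟨rfl, -, h0⟩ | ⟨h2, -⟩⟩ := hP
      · refine ⟨1, by simp [gExponent], fun i j => ?_⟩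
        rw [pow_one]
        refine lt_of_le_of_ne (hnn i j) fun hij => h0 ?_
        ext a b
        rw [Subsingleton.elim a i, Subsingleton.elim b j, ← hij, Matrix.zero_apply]
      · omega
    · obtain ⟨hk, hkn, hexp⟩ := hP.hasPredecessorExpansion hn
      obtain ⟨C, hCcard, hsucc, hclosed⟩ := exists_shortest_cycle_vertices hnn hs
      have hs1 : 1 ≤ s := hs.1.1
      have hsn : s ≤ n := by simpa [hCcard] using Finset.card_le_univ C
      have hC : C.Nonempty := Finset.card_pos.1 (by omega)
      have hk0 : (0 : ℤ) < k := by exact_mod_cast hk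
      obtain ⟨a, ha⟩ : ∃ a : ℕ, (a : ℤ) = ((n : ℤ) - s - 2) / (k : ℤ) + 2 := by
        refine Int.eq_ofNat_of_zero_le ?_ |>.imp fun _ h => h.symm
        -- The numerator is at least `-2` since `s ≤ n`.
        have : (-2 : ℤ) ≤ ((n : ℤ) - s - 2) / (k : ℤ) := by
          rw [Int.le_ediv_iff_mul_le hk0]
          nlinarith
        linarith
      have hna : n ≤ C.card + a * k := by
        -- This gives `(a - 1) * k ≥ n - s - 1`; one further `k ≥ 1` yields `a * k ≥ n - s`.
        have hlt := Int.lt_ediv_add_one_mul_self ((n : ℤ) - s - 2) hk0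
        rw [hCcard]
        zify
        rw [ha]
        nlinarith
      refine ⟨a + s * (n - max 2 k + 1), ?_, fun i j => ?_⟩
      · rw [gExponent_eq_of_two_le hn]
        push_cast [Nat.cast_sub (show max 2 k ≤ n by omega)]
        rw [ha]
      · obtain ⟨y, hy, hiy⟩ := hexp.exists_walk_into hnn hC hsucc hna i
        exact pow_add_apply_pos hnn hiy
          (hprim.pow_apply_pos_of_closed_walk hn hkn hexp hs1 (hclosed y hy) j)
  · subst hk
    rw [gExponent_eq_of_two_le hn]
    simp
    ring
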